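/- There are constants $c, C > 0$ such that for every integer $n \ge 1$, with $N = 3^n$, there are $N$ distinct parallelograms $P_1,\dots,P_N$ in $\mathbb R^2$, each with a well-defined pair of long sides (its sides being of two different lengths), such that the following hold. (i) Each $P_j$ has eccentricity between $cN$ and $CN$, where the eccentricity is the ratio of the length of the long sides to the length of the short sides; the same bounds hold for the ratio of the length of the long sides to the distance between the lines containing them. (ii) $\dfrac{c}{N} \le |P_j| \le \dfrac{C}{N}$ for every $j$. (iii) The long sides of every $P_j$ are non-vertical and their slope belongs to the standard middle-thirds Cantor set in $[0,1]$. (iv) $\displaystyle \Bigl|\bigcup_{j=1}^N P_j\Bigr| \le \frac{C}{\log N}$. (v) $\displaystyle \Bigl|\bigcup_{j=1}^N 2P_j\Bigr| \ge c\,\frac{\log\log N}{\log N}$, where $2P_j$ is the image of $P_j$ under dilation by the factor $2$ about its center. Here $|S|$ denotes the Lebesgue measure of $S\subset\mathbb R^2$. -/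

import Mathlib

open MeasureTheory

noncomputable section

/-- The Euclidean plane. -/
abbrev Plane : Type := EuclideanSpace ℝ (Fin 2)

/-- A nondegenerate parallelogram in the plane whose sides are of different lengths: the vertex
`base` and the two sides issuing from it, of which `longSide` is the longer one. -/
structure Parallelogram where
  base : Plane
  longSide : Plane
  shortSide : Plane
  linearIndependent : LinearIndependent ℝ ![longSide, shortSide]
  short_lt_long : ‖shortSide‖ < ‖longSide‖

namespace Parallelogram

/-- The (closed, solid) parallelogram as a set of points. -/
def carrier (P : Parallelogram) : Set Plane :=
  {x | ∃ a ∈ Set.Icc (0 : ℝ) 1, ∃ b ∈ Set.Icc (0 : ℝ) 1,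
    x = P.base + a • P.longSide + b • P.shortSide}

/-- The center of the parallelogram. -/
def center (P : Parallelogram) : Plane :=
  P.base + (1 / 2 : ℝ) • (P.longSide + P.shortSide)

/-- The double of the parallelogram: its dilate by the factor `2` about its center. -/
def double (P : Parallelogram) : Set Plane :=
  AffineMap.homothety P.center (2 : ℝ) '' P.carrier

/-- The width: the distance between the two parallel lines that contain the long sides. -/
def width (P : Parallelogram) : ℝ :=
  Metric.infDist P.shortSide (Submodule.span ℝ {P.longSide} : Set Plane)

/-- The eccentricity: the ratio of the length of the long sides to that of the short sides. -/
def eccentricity (P : Parallelogram) : ℝ :=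
  ‖P.longSide‖ / ‖P.shortSide‖

/-- The variant of the eccentricity that uses the width instead of the length of the short
sides. -/
def widthEccentricity (P : Parallelogram) : ℝ :=
  ‖P.longSide‖ / P.width

/-- The long sides are not vertical, and their slope belongs to `S`. -/
def LongSlopeMem (P : Parallelogram) (S : Set ℝ) : Prop :=
  P.longSide 0 ≠ 0 ∧ P.longSide 1 / P.longSide 0 ∈ S

end Parallelogram

end

/-!
Over every triadic interval `I_v ⊂ {0} × [0, 1]` of length `3⁻ⁿ` stands a strip
`{(x, y) | y - x * s_v ∈ I_v}`, whose slope `s_v` is read off the ternary digits of `v` by a *sticky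
map*: the `k`-th digit of `s_v`, which is `0` or `2`, depends only on the first `k` digits of `v`. The
parallelogram `P_v` is the part of the strip over `2 ≤ x ≤ 6`; its double contains the part over
`0 ≤ x ≤ 1`.

**The union of the `P_v` is small for a suitable sticky map.** Choose all digits by independent fair
coins. For fixed `x > 1` the covering probability `q_n(y)` satisfies a recursion (`coverProb_succ`)
that expresses survival of a critical percolation. As `x > 1`, at each vertex only one outcome of
the coin is favourable. The function `q ↦ q / (1 - q / 2)`, an electrical conductance, turns unions of
independent events into sums and fair coins into resistors in series (`mobius_or`, `mobius_half`).
Integrating the recursion over `y` and using the concavity of the series law gives `∫ q_n = O(1 / n)`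
(`integral_mobius_coverProb_le`), and a sticky map that is at least as good as the average exists.

**The union of the strips over `0 ≤ x ≤ 1` is large for every sticky map.** Let `f` count the strips
through a point. Then `∫ ∫ f / x` over `δ ≤ x ≤ 1` is `log (1 / δ)`, so by Cauchy–Schwarz the union has
area at least `log (1 / δ) ^ 2` divided by the energy `∫ ∫ f ^ 2 / x ^ 2`. Two strips whose addresses
separate at level `k` have slopes within `3⁻ᵏ`, so over small `x` they meet only if they lie close to a
common boundary of triadic intervals of level `k + 1`. Summing over pairs, each level contributes
`O(log (1 / δ))` to the energy, and strips near the diagonal contribute `O(1 / δ)`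
(`StickyMap.totalEnergy_le`). With `δ = 1 / (2 * n)` the energy is `O(n log n)`, and the area is at
least of order `log n / n`.
-/

/-! ### Triadic intervals and sticky maps -/

/-- Addresses of the triadic intervals of length `3⁻ⁿ` in `[0, 1]`: words of `n` ternary digits, the
most significant one first. -/
def TriadicIndex : ℕ → Type
  | 0 => Unit
  | n + 1 => Fin 3 × TriadicIndex n

instance TriadicIndex.instFintype : ∀ n, Fintype (TriadicIndex n)
  | 0 => inferInstanceAs (Fintype Unit)
  | n + 1 =>
    letI := TriadicIndex.instFintype n
    inferInstanceAs (Fintype (Fin 3 × TriadicIndex n))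

/-- A sticky map of depth `n`: a bit on every non-root vertex of the ternary tree of height `n`. The
bits along the path to a leaf are the digits (`2` for `true`, `0` for `false`) of the slope that the
leaf receives, so that leaves with a common ancestor of level `k` get slopes that agree to `k`
ternary digits. -/
def StickyMap : ℕ → Type
  | 0 => Unit
  | n + 1 => Fin 3 → Bool × StickyMap n

instance StickyMap.instFintype : ∀ n, Fintype (StickyMap n)
  | 0 => inferInstanceAs (Fintype Unit)
  | n + 1 =>
    letI := StickyMap.instFintype n
    inferInstanceAs (Fintype (Fin 3 → Bool × StickyMap n))

instance StickyMap.instNonempty : ∀ n, Nonempty (StickyMap n)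
  | 0 => inferInstanceAs (Nonempty Unit)
  | n + 1 =>
    letI := StickyMap.instNonempty n
    inferInstanceAs (Nonempty (Fin 3 → Bool × StickyMap n))

/-- The integer with ternary expansion `v`; the interval with address `v` is
`[pos v / 3ⁿ, (pos v + 1) / 3ⁿ]`. -/
def TriadicIndex.pos : (n : ℕ) → TriadicIndex n → ℕ
  | 0, _ => 0
  | n + 1, (i, v) => i * 3 ^ n + TriadicIndex.pos n v

/-- The slope assigned to the leaf `v`, a number with ternary digits in `{0, 2}`. -/
noncomputable def StickyMap.slope : (n : ℕ) → StickyMap n → TriadicIndex n → ℝ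
  | 0, _, _ => 0
  | n + 1, ω, (i, v) =>
    ((if (ω i).1 then 2 else 0) + StickyMap.slope n (ω i).2 v) / 3

/-- The slice at abscissa `x` of the union of the strips
`{(x, y) | y - x * slope v ∈ [pos v / 3ⁿ, (pos v + 1) / 3ⁿ]}` over all addresses `v`. -/
def StickyMap.slice (n : ℕ) (ω : StickyMap n) (x : ℝ) : Set ℝ :=
  {y | ∃ v : TriadicIndex n, (v.pos n : ℝ) / 3 ^ n ≤ y - x * ω.slope n v ∧
    y - x * ω.slope n v ≤ (v.pos n + 1) / 3 ^ n}

theorem TriadicIndex.card (n : ℕ) : Fintype.card (TriadicIndex n) = 3 ^ n := by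
  induction n with
  | zero => rfl
  | succ n ih =>
    have : Fintype.card (TriadicIndex (n + 1)) = Fintype.card (Fin 3 × TriadicIndex n) := rfl
    rw [this, Fintype.card_prod, ih, Fintype.card_fin, pow_succ, mul_comm]

theorem TriadicIndex.sum_succ {M : Type*} [AddCommMonoid M] (n : ℕ)
    (f : TriadicIndex (n + 1) → M) :
    ∑ v, f v = ∑ i : Fin 3, ∑ v : TriadicIndex n, f (i, v) :=
  Fintype.sum_prod_type (α₁ := Fin 3) (α₂ := TriadicIndex n) f

theorem TriadicIndex.sum_pos {M : Type*} [AddCommMonoid M] (n : ℕ) (f : ℕ → M) :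
    ∑ v : TriadicIndex n, f (v.pos n) = ∑ a ∈ Finset.range (3 ^ n), f a := by
  induction n generalizing f with
  | zero =>
    have : ∑ v : TriadicIndex 0, f (v.pos 0) = ∑ v : Unit, f 0 := rfl
    rw [this]; simp
  | succ n ih =>
    rw [TriadicIndex.sum_succ]
    have h3 : 3 ^ (n + 1) = 3 ^ n + 3 ^ n + 3 ^ n := by ring
    rw [h3, Finset.sum_range_add, Finset.sum_range_add, Fin.sum_univ_three]
    simp only [TriadicIndex.pos]
    have h (c : ℕ) := ih (fun a => f (c + a))
    rw [h, h, h]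
    congr 1
    · simp
    · simp [two_mul]

theorem TriadicIndex.pos_lt (n : ℕ) (v : TriadicIndex n) : v.pos n < 3 ^ n := by
  induction n with
  | zero => exact Nat.one_pos
  | succ n ih =>
    obtain ⟨i, v⟩ := v
    have := ih v
    have hi : (i : ℕ) ≤ 2 := by omega
    have := Nat.mul_le_mul_right (3 ^ n) hi
    simp only [TriadicIndex.pos, pow_succ]
    omega

theorem TriadicIndex.pos_injective (n : ℕ) : Function.Injective (TriadicIndex.pos n) := by
  induction n with
  | zero => intro v w _; rfl
  | succ n ih =>
    rintro ⟨i, v⟩ ⟨j, w⟩ h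
    have hv := v.pos_lt n
    have hw := w.pos_lt n
    simp only [TriadicIndex.pos] at h
    have hij : (i : ℕ) = j := by
      rcases lt_trichotomy (i : ℕ) j with hlt | heq | hlt
      · have := Nat.mul_le_mul_right (3 ^ n) (Nat.succ_le_of_lt hlt)
        rw [Nat.succ_mul] at this; omega
      · exact heq
      · have := Nat.mul_le_mul_right (3 ^ n) (Nat.succ_le_of_lt hlt)
        rw [Nat.succ_mul] at this; omega
    have hij' : i = j := Fin.ext hij
    subst hij'
    rw [ih (by omega : v.pos n = w.pos n)]

theorem cantorSet_digit {s : ℝ} (hs : s ∈ cantorSet) (b : Bool) :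
    ((if b then 2 else 0) + s) / 3 ∈ cantorSet := by
  rw [cantorSet_eq_union_halves]
  cases b
  · left; exact ⟨s, hs, by simp⟩
  · right; exact ⟨s, hs, by simp⟩

theorem StickyMap.slope_mem (n : ℕ) (ω : StickyMap n) (v : TriadicIndex n) :
    ω.slope n v ∈ cantorSet := by
  induction n with
  | zero => exact zero_mem_cantorSet
  | succ n ih => exact cantorSet_digit (ih _ _) _

theorem StickyMap.slope_mem_Icc (n : ℕ) (ω : StickyMap n) (v : TriadicIndex n) :
    ω.slope n v ∈ Set.Icc (0 : ℝ) 1 :=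
  cantorSet_subset_unitInterval (ω.slope_mem n v)

theorem StickyMap.slice_subset (n : ℕ) (ω : StickyMap n) {x : ℝ} (hx : 0 ≤ x) :
    ω.slice n x ⊆ Set.Icc 0 (1 + x) := by
  rintro y ⟨v, h1, h2⟩
  obtain ⟨h3, h4⟩ := ω.slope_mem_Icc n v
  have h5 : (0 : ℝ) ≤ (v.pos n : ℝ) / 3 ^ n := by positivity
  have h6 : ((v.pos n : ℝ) + 1) / 3 ^ n ≤ 1 := by
    rw [div_le_one (by positivity)]
    exact_mod_cast v.pos_lt n
  constructor <;> nlinarith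

/-- Self-similarity: the slice of depth `n + 1` is a union of three copies, contracted by `3`, of
slices of depth `n`, the `i`-th one translated according to the first digit `i` and its bit. -/
theorem StickyMap.mem_slice_succ (n : ℕ) (ω : StickyMap (n + 1)) (x y : ℝ) :
    y ∈ ω.slice (n + 1) x ↔
      ∃ i : Fin 3, 3 * y - i - (if (ω i).1 then 2 * x else 0) ∈ (ω i).2.slice n x := by
  have h3 : (0 : ℝ) < 3 ^ n := by positivity
  have key (i : Fin 3) (v : TriadicIndex n) :
      ((TriadicIndex.pos (n + 1) (i, v) : ℝ) / 3 ^ (n + 1) ≤ y - x * ω.slope (n + 1) (i, v) ∧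
      y - x * ω.slope (n + 1) (i, v) ≤ (TriadicIndex.pos (n + 1) (i, v) + 1) / 3 ^ (n + 1)) ↔
      ((v.pos n : ℝ) / 3 ^ n ≤ 3 * y - i - (if (ω i).1 then 2 * x else 0)
          - x * (ω i).2.slope n v ∧
        3 * y - i - (if (ω i).1 then 2 * x else 0) - x * (ω i).2.slope n v
          ≤ (v.pos n + 1) / 3 ^ n) := by
    simp only [TriadicIndex.pos, StickyMap.slope, Nat.cast_add, Nat.cast_mul, Nat.cast_pow,
      Nat.cast_ofNat]
    have e1 : ((i : ℕ) * 3 ^ n + (v.pos n : ℝ)) / 3 ^ (n + 1)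
        = ((i : ℕ) + (v.pos n : ℝ) / 3 ^ n) / 3 := by
      field_simp; ring
    have e2 : ((i : ℕ) * 3 ^ n + (v.pos n : ℝ) + 1) / 3 ^ (n + 1)
        = ((i : ℕ) + ((v.pos n : ℝ) + 1) / 3 ^ n) / 3 := by
      field_simp; ring
    rw [e1, e2]
    split_ifs <;> constructor <;> rintro ⟨h1, h2⟩ <;> constructor <;> linarith
  constructor
  · rintro ⟨⟨i, v⟩, h⟩
    exact ⟨i, v, (key i v).1 h⟩
  · rintro ⟨i, v, h⟩
    exact ⟨(i, v), (key i v).2 h⟩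

/-! ### The covering probability of a point -/

/-- The probability that `(x, y)` is covered by the strips of a uniformly random sticky map. -/
noncomputable def coverProb (n : ℕ) (x y : ℝ) : ℝ :=
  (∑ ω : StickyMap n, (ω.slice n x).indicator 1 y) / Fintype.card (StickyMap n)

/-- The function `q ↦ q / (1 - q / 2)`. It is `2 tanh (α / 2)` for `q = 1 - exp (-α)`, which makes it
subadditive under the union of independent events (`mobius_or`); halving `q`
turns the resistance `r = 1 / mobius q` into `2 * r + 1 / 2` (`mobius_half`). -/
noncomputable def mobius (q : ℝ) : ℝ := 2 * q / (2 - q)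

theorem mobius_nonneg {q : ℝ} (h0 : 0 ≤ q) (h1 : q ≤ 1) : 0 ≤ mobius q :=
  div_nonneg (by linarith) (by linarith)

theorem mobius_le_two {q : ℝ} (h1 : q ≤ 1) : mobius q ≤ 2 := by
  unfold mobius
  rw [div_le_iff₀ (by linarith)]; linarith

theorem le_mobius {q : ℝ} (h0 : 0 ≤ q) (h1 : q ≤ 1) : q ≤ mobius q := by
  unfold mobius
  rw [le_div_iff₀ (by linarith)]; nlinarith

theorem mobius_or {a b : ℝ} (ha : a ∈ Set.Icc (0 : ℝ) 1) (hb : b ∈ Set.Icc (0 : ℝ) 1) :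
    mobius (1 - (1 - a) * (1 - b)) ≤ mobius a + mobius b := by
  obtain ⟨ha0, ha1⟩ := ha
  obtain ⟨hb0, hb1⟩ := hb
  have hu0 : 0 ≤ 1 - (1 - a) * (1 - b) := by nlinarith
  have hu1 : 1 - (1 - a) * (1 - b) ≤ 1 := by nlinarith
  -- The addition theorem of the hyperbolic tangent.
  have key : mobius (1 - (1 - a) * (1 - b)) * (1 + mobius a * mobius b / 4)
      = mobius a + mobius b := by
    unfold mobius
    have h1 : 2 - a ≠ 0 := by linarith
    have h2 : 2 - b ≠ 0 := by linarith
    have h3 : 2 - (1 - (1 - a) * (1 - b)) ≠ 0 := by linarith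
    field_simp
    ring
  nlinarith [mul_nonneg (mobius_nonneg hu0 hu1)
    (mul_nonneg (mobius_nonneg ha0 ha1) (mobius_nonneg hb0 hb1))]

/-- The map `mobius q ↦ mobius (q / 2)` is concave; the right-hand side is its tangent line at
`mobius q = 4 / k`. -/
theorem mobius_half {q k : ℝ} (h1 : q ≤ 1) (hk : 0 ≤ k) :
    mobius (q / 2) ≤ 2 / (k + 1) ^ 2 + k ^ 2 / (2 * (k + 1) ^ 2) * mobius q := by
  have e : 2 / (k + 1) ^ 2 + k ^ 2 / (2 * (k + 1) ^ 2) * mobius q - mobius (q / 2)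
      = ((k + 2) * q - 4) ^ 2 / ((k + 1) ^ 2 * (2 - q) * (4 - q)) := by
    unfold mobius
    have h2 : 2 - q ≠ 0 := by linarith
    have h4 : 4 - q ≠ 0 := by linarith
    have h5 : 2 - q / 2 ≠ 0 := by linarith
    have h6 : k + 1 ≠ 0 := by linarith
    have h7 : 2 * (q / 2) / (2 - q / 2) = 2 * q / (4 - q) := by
      rw [div_eq_div_iff h5 h4]; ring
    rw [h7]
    field_simp
    ring
  have : 0 ≤ ((k + 2) * q - 4) ^ 2 / ((k + 1) ^ 2 * (2 - q) * (4 - q)) :=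
    div_nonneg (sq_nonneg _) (mul_nonneg (mul_nonneg (sq_nonneg _) (by linarith)) (by linarith))
  linarith

theorem coverProb_mem (n : ℕ) (x y : ℝ) : coverProb n x y ∈ Set.Icc (0 : ℝ) 1 := by
  have hc : (0 : ℝ) < Fintype.card (StickyMap n) := by exact_mod_cast Fintype.card_pos
  constructor
  · exact div_nonneg (Finset.sum_nonneg fun ω _ => Set.indicator_nonneg (fun _ _ => zero_le_one) _)
      hc.le
  · unfold coverProb
    rw [div_le_one hc]
    calc _ ≤ ∑ _ω : StickyMap n, (1 : ℝ) :=
          Finset.sum_le_sum fun ω _ => Set.indicator_le_self' (fun _ _ => zero_le_one) _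
      _ = _ := by simp

theorem coverProb_eq_zero (n : ℕ) {x y : ℝ} (hx : 0 ≤ x) (hy : y ∉ Set.Icc 0 (1 + x)) :
    coverProb n x y = 0 := by
  unfold coverProb
  rw [Finset.sum_eq_zero, zero_div]
  intro ω _
  exact Set.indicator_of_notMem (fun h => hy (ω.slice_subset n hx h)) _

/-- The bits and the sticky maps on the three subtrees are independent, so the probabilities of not
being covered multiply. -/
theorem coverProb_succ (n : ℕ) (x y : ℝ) :
    coverProb (n + 1) x y =
      1 - ∏ i : Fin 3, (1 - (coverProb n x (3 * y - i) + coverProb n x (3 * y - i - 2 * x)) / 2) := by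
  classical
  have hc : (Fintype.card (StickyMap n) : ℝ) ≠ 0 := by exact_mod_cast Fintype.card_ne_zero
  have hcard : (Fintype.card (StickyMap (n + 1)) : ℝ)
      = (2 * Fintype.card (StickyMap n)) ^ 3 := by
    have : Fintype.card (StickyMap (n + 1)) = Fintype.card (Fin 3 → Bool × StickyMap n) := rfl
    rw [this]; simp
  let F : Fin 3 → Bool × StickyMap n → ℝ := fun i p =>
    1 - (p.2.slice n x).indicator 1 (3 * y - i - (if p.1 then 2 * x else 0))
  have hF (ω : StickyMap (n + 1)) :
      (1 : ℝ) - (ω.slice (n + 1) x).indicator 1 y = ∏ i, F i (ω i) := by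
    by_cases h : y ∈ ω.slice (n + 1) x
    · rw [Set.indicator_of_mem h]
      obtain ⟨i, hi⟩ := (ω.mem_slice_succ n x y).1 h
      rw [Finset.prod_eq_zero (Finset.mem_univ i)]
      · simp
      · simp only [F]; rw [Set.indicator_of_mem hi]; simp
    · rw [Set.indicator_of_notMem h, Finset.prod_eq_one]
      · simp
      · intro i _
        simp only [F]
        rw [Set.indicator_of_notMem, sub_zero]
        exact fun hi => h ((ω.mem_slice_succ n x y).2 ⟨i, hi⟩)
  -- A sticky map of depth `n + 1` is a choice of a pair (bit, sticky map of depth `n`) for each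
  -- digit: the sum over all choices of a product factors.
  have hsum : ∑ ω : StickyMap (n + 1), ∏ i, F i (ω i) = ∏ i, ∑ p, F i p := by
    have := Finset.prod_univ_sum (fun _ : Fin 3 => (Finset.univ : Finset (Bool × StickyMap n))) F
    rw [this, Fintype.piFinset_univ]
    rfl
  have hFi (i : Fin 3) : ∑ p, F i p = (2 * Fintype.card (StickyMap n)) *
      (1 - (coverProb n x (3 * y - i) + coverProb n x (3 * y - i - 2 * x)) / 2) := by
    rw [Fintype.sum_prod_type]
    simp only [F, Fintype.sum_bool, if_true, Finset.sum_sub_distrib, coverProb]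
    simp
    field_simp
    ring
  have htot : ∑ ω : StickyMap (n + 1), (ω.slice (n + 1) x).indicator 1 y
      = (Fintype.card (StickyMap (n + 1)) : ℝ) - ∏ i, ∑ p, F i p := by
    rw [← hsum, ← Finset.sum_congr rfl fun ω _ => hF ω, Finset.sum_sub_distrib]
    simp
  rw [coverProb, htot, Finset.prod_congr rfl fun i _ => hFi i, Finset.prod_mul_distrib,
    hcard]
  simp only [Finset.prod_const, Finset.card_univ, Fintype.card_fin]
  field_simp

/-- The recursion of `coverProb` after applying `mobius`. As `x > 1`, at most one of the two bits at
a vertex allows the point to be covered, so that each of the three factors is a fair coin toss. -/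
theorem mobius_coverProb_succ (n : ℕ) {x : ℝ} (hx : 1 < x) (y : ℝ) {k : ℝ} (hk : 0 ≤ k) :
    mobius (coverProb (n + 1) x y) ≤
      ∑ i : Fin 3, ∑ b : Bool,
        (Set.Icc 0 (1 + x)).indicator (fun z => 2 / (k + 1) ^ 2 +
          k ^ 2 / (2 * (k + 1) ^ 2) * mobius (coverProb n x z))
          (3 * y - (i + if b then 2 * x else 0)) := by
  set G : ℝ → ℝ := (Set.Icc 0 (1 + x)).indicator (fun z => 2 / (k + 1) ^ 2 +
          k ^ 2 / (2 * (k + 1) ^ 2) * mobius (coverProb n x z)) with hG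
  set a : Fin 3 → ℝ := fun i =>
    (coverProb n x (3 * y - i) + coverProb n x (3 * y - i - 2 * x)) / 2 with ha
  have hx0 : 0 ≤ x := by linarith
  have hG0 (z : ℝ) : 0 ≤ G z := by
    refine Set.indicator_nonneg (fun z _ => ?_) z
    have := mobius_nonneg (coverProb_mem n x z).1 (coverProb_mem n x z).2
    positivity
  have hGz (z : ℝ) : mobius (coverProb n x z / 2) ≤ G z := by
    by_cases hz : z ∈ Set.Icc 0 (1 + x)
    · rw [hG, Set.indicator_of_mem hz]
      exact mobius_half (coverProb_mem n x z).2 hk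
    · rw [coverProb_eq_zero n hx0 hz]
      simpa [mobius] using hG0 z
  have ha01 (i : Fin 3) : a i ∈ Set.Icc (0 : ℝ) 1 := by
    have h1 := coverProb_mem n x (3 * y - i)
    have h2 := coverProb_mem n x (3 * y - i - 2 * x)
    constructor <;> simp only [ha] <;> linarith [h1.1, h1.2, h2.1, h2.2]
  have hai (i : Fin 3) : mobius (a i) ≤ ∑ b : Bool, G (3 * y - (i + if b then 2 * x else 0)) := by
    rw [Fintype.sum_bool]
    simp only [if_true, add_zero, ha, ← sub_sub, Bool.false_eq_true, if_false]
    -- The two arguments differ by `2 * x > 1 + x`, so one of the two probabilities vanishes.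
    by_cases hz : 3 * y - i ∈ Set.Icc 0 (1 + x)
    · rw [coverProb_eq_zero n hx0 (y := 3 * y - i - 2 * x)
        (fun h => by linarith [h.1, hz.2]), add_zero]
      linarith [hGz (3 * y - i), hG0 (3 * y - i - 2 * x)]
    · rw [coverProb_eq_zero n hx0 hz, zero_add]
      linarith [hGz (3 * y - i - 2 * x), hG0 (3 * y - i)]
  rw [coverProb_succ, Fin.prod_univ_three, Fin.sum_univ_three]
  have h01 : 1 - (1 - a 0) * (1 - a 1) ∈ Set.Icc (0 : ℝ) 1 := by
    obtain ⟨p0, p1⟩ := ha01 0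
    obtain ⟨r0, r1⟩ := ha01 1
    constructor <;> nlinarith
  have h1 := mobius_or (ha01 0) (ha01 1)
  have h2 := mobius_or h01 (ha01 2)
  rw [sub_sub_cancel] at h2
  linarith [hai 0, hai 1, hai 2]

theorem StickyMap.slice_eq_iUnion (n : ℕ) (ω : StickyMap n) (x : ℝ) :
    ω.slice n x = ⋃ v : TriadicIndex n, Set.Icc ((v.pos n : ℝ) / 3 ^ n + x * ω.slope n v)
      ((v.pos n + 1 : ℝ) / 3 ^ n + x * ω.slope n v) := by
  ext y
  simp only [StickyMap.slice, Set.mem_ofPred_eq, Set.mem_iUnion, Set.mem_Icc]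
  refine exists_congr fun v => ?_
  constructor <;> rintro ⟨h1, h2⟩ <;> constructor <;> linarith

theorem StickyMap.measurableSet_slice (n : ℕ) (ω : StickyMap n) (x : ℝ) :
    MeasurableSet (ω.slice n x) := by
  rw [StickyMap.slice_eq_iUnion]
  exact MeasurableSet.iUnion fun v => measurableSet_Icc

theorem measurable_coverProb (n : ℕ) (x : ℝ) : Measurable (coverProb n x) := by
  unfold coverProb
  refine Measurable.div_const ?_ _
  exact Finset.measurable_fun_sum _ fun ω _ =>
    measurable_one.indicator (ω.measurableSet_slice n x)

theorem measurable_mobius_coverProb (n : ℕ) (x : ℝ) :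
    Measurable fun y => mobius (coverProb n x y) := by
  have := measurable_coverProb n x
  unfold mobius
  fun_prop

theorem integrable_mobius_coverProb (n : ℕ) {x : ℝ} (hx : 0 ≤ x) :
    Integrable fun y => mobius (coverProb n x y) := by
  have h : IntegrableOn (fun y => mobius (coverProb n x y)) (Set.Icc 0 (1 + x)) := by
    refine Measure.integrableOn_of_bounded (M := 2) (by simp)
      (measurable_mobius_coverProb n x).aestronglyMeasurable (ae_of_all _ fun y => ?_)
    have := coverProb_mem n x y
    rw [Real.norm_of_nonneg (mobius_nonneg this.1 this.2)]
    exact mobius_le_two this.2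
  refine (integrableOn_iff_integrable_of_support_subset ?_).1 h
  intro y hy
  by_contra hy'
  exact hy (by simp [coverProb_eq_zero n hx hy', mobius])

theorem integral_comp_three_mul_sub (G : ℝ → ℝ) (c : ℝ) :
    ∫ y, G (3 * y - c) = (∫ y, G y) / 3 := by
  have h := Measure.integral_comp_mul_left (fun y => G (y - c)) (3 : ℝ)
  rw [h, integral_sub_right_eq_self G c]
  rw [abs_of_pos (by norm_num), smul_eq_mul]; ring

/-- The decay `O(1 / n)` of critical percolation. The recursion has six branches, each contracting by
`3`, and a coin toss halves the probability, so the linear part preserves the integral; the loss comes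
from the concavity in `mobius_half`, applied with `k = n + 1`, the value of `4 / mobius q` at which the
bound for depth `n` would be attained by a constant. -/
theorem integral_mobius_coverProb_le (n : ℕ) {x : ℝ} (hx : 1 < x) :
    ∫ y, mobius (coverProb n x y) ≤ 4 * (1 + x) / (n + 1) := by
  have hx0 : 0 ≤ x := by linarith
  have hvol : volume.real (Set.Icc 0 (1 + x)) = 1 + x := by
    rw [Real.volume_real_Icc_of_le (by linarith)]; ring
  have hsupp (m : ℕ) (y : ℝ) (hy : y ∉ Set.Icc 0 (1 + x)) : mobius (coverProb m x y) = 0 := by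
    simp [coverProb_eq_zero m hx0 hy, mobius]
  induction n with
  | zero =>
    have h1 : ∫ y, mobius (coverProb 0 x y) ≤ ∫ y, (Set.Icc 0 (1 + x)).indicator (fun _ => (2 : ℝ)) y := by
      refine integral_mono (integrable_mobius_coverProb 0 hx0) ?_ fun y => ?_
      · exact (integrable_indicator_iff measurableSet_Icc).2 (by simp)
      · by_cases hy : y ∈ Set.Icc 0 (1 + x)
        · simp only [Set.indicator_of_mem hy]
          exact mobius_le_two (coverProb_mem 0 x y).2
        · simp only [Set.indicator_of_notMem hy, hsupp 0 y hy, le_refl]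
    rw [integral_indicator measurableSet_Icc, setIntegral_const, hvol, smul_eq_mul] at h1
    norm_num
    linarith
  | succ n ih =>
    set k : ℝ := n + 1 with hk
    have hk0 : 0 < k := by positivity
    set G : ℝ → ℝ := (Set.Icc 0 (1 + x)).indicator (fun z => 2 / (k + 1) ^ 2 +
          k ^ 2 / (2 * (k + 1) ^ 2) * mobius (coverProb n x z)) with hG
    have hint : IntegrableOn (fun z => k ^ 2 / (2 * (k + 1) ^ 2) * mobius (coverProb n x z))
        (Set.Icc 0 (1 + x)) :=
      ((integrable_mobius_coverProb n hx0).const_mul _).integrableOn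
    have hconst : IntegrableOn (fun _ : ℝ => 2 / (k + 1) ^ 2) (Set.Icc 0 (1 + x)) := by simp
    have hGint : Integrable G :=
      (integrable_indicator_iff measurableSet_Icc).2 (hconst.add hint)
    have hGval : ∫ z, G z = 2 / (k + 1) ^ 2 * (1 + x) +
        k ^ 2 / (2 * (k + 1) ^ 2) * ∫ y, mobius (coverProb n x y) := by
      rw [hG, integral_indicator measurableSet_Icc, integral_add hconst.integrable hint.integrable,
        setIntegral_const, hvol, integral_const_mul,
        setIntegral_eq_integral_of_forall_compl_eq_zero (fun y hy => hsupp n y hy), smul_eq_mul]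
      ring
    have hcomp (c : ℝ) : Integrable fun y => G (3 * y - c) :=
      ((hGint.comp_sub_right c).comp_mul_left' (by norm_num : (3 : ℝ) ≠ 0))
    have h1 : ∫ y, mobius (coverProb (n + 1) x y) ≤
        ∫ y, ∑ i : Fin 3, ∑ b : Bool, G (3 * y - (i + if b then 2 * x else 0)) := by
      refine integral_mono (integrable_mobius_coverProb (n + 1) hx0) ?_
        fun y => mobius_coverProb_succ n hx y hk0.le
      exact integrable_finsetSum _ fun i _ => integrable_finsetSum _ fun b _ => hcomp _
    have h2 : ∫ y, ∑ i : Fin 3, ∑ b : Bool, G (3 * y - (i + if b then 2 * x else 0))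
        = 2 * ∫ z, G z := by
      rw [integral_finsetSum _ fun i _ => integrable_finsetSum _ fun b _ => hcomp _]
      have h3 (i : Fin 3) : ∫ y, ∑ b : Bool, G (3 * y - (i + if b then 2 * x else 0))
          = ∑ b : Bool, (∫ z, G z) / 3 := by
        rw [integral_finsetSum _ fun b _ => hcomp _]
        exact Finset.sum_congr rfl fun b _ => integral_comp_three_mul_sub G _
      rw [Finset.sum_congr rfl fun i _ => h3 i]
      simp
      ring
    rw [h2, hGval] at h1
    have h4 : k ^ 2 / (2 * (k + 1) ^ 2) * ∫ y, mobius (coverProb n x y)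
        ≤ k ^ 2 / (2 * (k + 1) ^ 2) * (4 * (1 + x) / k) := by gcongr
    have h5 : 2 * (2 / (k + 1) ^ 2 * (1 + x) + k ^ 2 / (2 * (k + 1) ^ 2) * (4 * (1 + x) / k))
        = 4 * (1 + x) / (k + 1) := by
      field_simp
      ring
    push_cast
    rw [← hk]
    linarith

theorem sum_volume_slice_le (n : ℕ) {x : ℝ} (hx : 1 < x) :
    ∑ ω : StickyMap n, volume (ω.slice n x) ≤
      Fintype.card (StickyMap n) * ENNReal.ofReal (4 * (1 + x) / (n + 1)) := by
  have hx0 : 0 ≤ x := by linarith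
  have hc : (0 : ℝ) < Fintype.card (StickyMap n) := by exact_mod_cast Fintype.card_pos
  have hfin (ω : StickyMap n) : volume (ω.slice n x) < ⊤ :=
    (measure_mono (ω.slice_subset n hx0)).trans_lt (by simp)
  have hi (ω : StickyMap n) : Integrable ((ω.slice n x).indicator (1 : ℝ → ℝ)) :=
    (integrable_indicator_iff (ω.measurableSet_slice n x)).2
      (integrableOn_const (hfin ω).ne)
  have h1 : ∑ ω : StickyMap n, volume.real (ω.slice n x)
      = Fintype.card (StickyMap n) * ∫ y, coverProb n x y := by
    unfold coverProb
    rw [integral_div, integral_finsetSum _ fun ω _ => hi ω]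
    rw [mul_div_cancel₀ _ hc.ne']
    refine Finset.sum_congr rfl fun ω _ => ?_
    rw [integral_indicator_one (ω.measurableSet_slice n x)]
  have h2 : ∫ y, coverProb n x y ≤ ∫ y, mobius (coverProb n x y) := by
    refine integral_mono ?_ (integrable_mobius_coverProb n hx0)
      fun y => le_mobius (coverProb_mem n x y).1 (coverProb_mem n x y).2
    exact (integrable_finsetSum _ fun ω _ => hi ω).div_const _
  have h3 : ∑ ω : StickyMap n, volume (ω.slice n x)
      = ENNReal.ofReal (∑ ω : StickyMap n, volume.real (ω.slice n x)) := by
    rw [ENNReal.ofReal_sum_of_nonneg fun _ _ => measureReal_nonneg]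
    exact Finset.sum_congr rfl fun ω _ => (ofReal_measureReal (hfin ω).ne).symm
  rw [h3, h1, ENNReal.ofReal_mul hc.le, ENNReal.ofReal_natCast]
  gcongr
  exact h2.trans (integral_mobius_coverProb_le n hx)

/-! ### The overlap of two thin strips -/

theorem integrableOn_div_sq {δ : ℝ} (hδ : 0 < δ) {g : ℝ → ℝ} (hg : Continuous g) :
    IntegrableOn (fun x => g x / x ^ 2) (Set.Icc δ 1) := by
  refine ContinuousOn.integrableOn_Icc ?_
  refine hg.continuousOn.div (by fun_prop) fun x hx => ?_
  have : 0 < x := hδ.trans_le hx.1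
  positivity

/-- An integrand that is at most `M` on `[a, b]` and nonpositive elsewhere. -/
theorem setIntegral_le_const_mul {δ a b M : ℝ} {g : ℝ → ℝ}
    (hg : IntegrableOn g (Set.Icc δ 1)) (hM : 0 ≤ M) (hab : a ≤ b)
    (h1 : ∀ x ∈ Set.Icc δ 1, g x ≤ M) (h0 : ∀ x ∈ Set.Icc δ 1, x ∉ Set.Icc a b → g x ≤ 0) :
    ∫ x in Set.Icc δ 1, g x ≤ M * (b - a) := by
  have hind : Integrable ((Set.Icc a b).indicator fun _ : ℝ => M) :=
    (integrable_indicator_iff measurableSet_Icc).2 (by simp)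
  calc ∫ x in Set.Icc δ 1, g x ≤ ∫ x in Set.Icc δ 1, (Set.Icc a b).indicator (fun _ => M) x := by
        refine setIntegral_mono_on hg hind.integrableOn measurableSet_Icc fun x hx => ?_
        by_cases hxa : x ∈ Set.Icc a b
        · rw [Set.indicator_of_mem hxa]; exact h1 x hx
        · rw [Set.indicator_of_notMem hxa]; exact h0 x hx hxa
    _ ≤ ∫ x, (Set.Icc a b).indicator (fun _ => M) x :=
        setIntegral_le_integral hind (ae_of_all _ fun x => Set.indicator_nonneg (fun _ _ => hM) x)
    _ = M * (b - a) := by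
        rw [integral_indicator measurableSet_Icc, setIntegral_const,
          Real.volume_real_Icc_of_le hab, smul_eq_mul, mul_comm]

/-- The length of the intersection of two intervals of length `h` whose left endpoints differ by
`D + x * d`: the slice at abscissa `x` of the intersection of two strips of vertical width `h`, with
offset `D` between their bases and difference `d` of their slopes. -/
noncomputable def overlap (h D d x : ℝ) : ℝ := max 0 (h - |D + x * d|)

theorem continuous_overlap (h D d : ℝ) : Continuous (overlap h D d) := by
  unfold overlap; fun_prop

theorem overlap_le {h : ℝ} (hh : 0 ≤ h) (D d x : ℝ) : overlap h D d x ≤ h :=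
  max_le hh (by linarith [abs_nonneg (D + x * d)])

theorem overlap_neg (h D d x : ℝ) : overlap h (-D) (-d) x = overlap h D d x := by
  unfold overlap
  rw [← abs_neg (D + x * d)]; ring_nf

/-- The overlap of two strips over `δ ≤ x ≤ 1`, weighted by `1 / x ^ 2`. -/
noncomputable def energy (δ h D d : ℝ) : ℝ := ∫ x in Set.Icc δ 1, overlap h D d x / x ^ 2

theorem integral_inv_sq_le {δ : ℝ} (hδ : 0 < δ) (hδ1 : δ ≤ 1) :
    ∫ x in Set.Icc δ 1, 1 / x ^ 2 ≤ 1 / δ := by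
  rw [integral_Icc_eq_integral_Ioc, ← intervalIntegral.integral_of_le hδ1]
  have h : ∫ x in δ..1, 1 / x ^ 2 = -1⁻¹ - -δ⁻¹ := by
    refine intervalIntegral.integral_eq_sub_of_hasDerivAt (f := fun x => -x⁻¹) (fun x hx => ?_) ?_
    · rw [Set.uIcc_of_le hδ1] at hx
      have hx0 : x ≠ 0 := (hδ.trans_le hx.1).ne'
      have := (hasDerivAt_inv hx0).fun_neg
      rwa [neg_neg, ← one_div] at this
    · have := (integrableOn_div_sq hδ (continuous_const (y := (1 : ℝ))))
      rwa [intervalIntegrable_iff_integrableOn_Icc_of_le hδ1]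
  rw [h]
  norm_num

theorem energy_le_trivial {δ h : ℝ} (hδ : 0 < δ) (hδ1 : δ ≤ 1) (hh : 0 ≤ h) (D d : ℝ) :
    energy δ h D d ≤ h / δ := by
  have h1 : energy δ h D d ≤ ∫ x in Set.Icc δ 1, h * (1 / x ^ 2) := by
    refine setIntegral_mono_on (integrableOn_div_sq hδ (continuous_overlap h D d))
      ((integrableOn_div_sq hδ continuous_const).const_mul h) measurableSet_Icc
      fun x hx => ?_
    have : 0 < x := hδ.trans_le hx.1
    rw [mul_one_div]
    gcongr
    exact overlap_le hh D d x
  rw [integral_const_mul] at h1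
  have := mul_le_mul_of_nonneg_left (integral_inv_sq_le hδ hδ1) hh
  rw [mul_one_div] at this
  exact h1.trans this

/-- Two strips whose bases are separated by at least `l` widths meet only for `x` in an interval of
length at most `2 * h / |d|`, on which `x ≥ max δ (l * h / |d|)`. -/
theorem energy_le {δ h D d : ℝ} (hδ : 0 < δ) (hδ1 : δ ≤ 1) (hh : 0 < h) (l : ℕ)
    (hD : (l + 1) * h ≤ D) (hd : |d| ≤ 1) :
    energy δ h D d ≤ 16 * h / ((l + 1) * (δ + l * h)) := by
  rcases Nat.eq_zero_or_pos l with rfl | hl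
  · refine (energy_le_trivial hδ hδ1 hh.le D d).trans ?_
    simp only [Nat.cast_zero, zero_add, one_mul, zero_mul, add_zero]
    gcongr
    linarith
  have hl1 : (1 : ℝ) ≤ l := by exact_mod_cast hl
  have hlh : 0 < l * h := by positivity
  have hrhs : 0 < 16 * h / ((l + 1) * (δ + l * h)) := by positivity
  have hnz {x : ℝ} (hx0 : 0 < x) (hpos : ¬ overlap h D d x / x ^ 2 ≤ 0) : |D + x * d| < h := by
    by_contra hc
    apply hpos
    rw [overlap, max_eq_left (by linarith), zero_div]
  rcases le_or_gt 0 d with hd0 | hd0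
  · refine le_trans ?_ hrhs.le
    refine setIntegral_nonpos measurableSet_Icc fun x hx => ?_
    have hx0 : 0 < x := hδ.trans_le hx.1
    by_contra hc
    have := (abs_lt.1 (hnz hx0 hc)).2
    nlinarith [mul_nonneg hx0.le hd0]
  · obtain ⟨e, rfl⟩ : ∃ e, d = -e := ⟨-d, by simp⟩
    have he0 : 0 < e := by linarith
    have he1 : e ≤ 1 := by rw [abs_neg, abs_of_pos he0] at hd; exact hd
    have hM : ∀ x ∈ Set.Icc δ 1, overlap h D (-e) x / x ^ 2 ≤
        4 * h / (δ + l * h / e) ^ 2 := by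
      intro x hx
      have hx0 : 0 < x := hδ.trans_le hx.1
      by_cases hc : overlap h D (-e) x / x ^ 2 ≤ 0
      · exact hc.trans (by positivity)
      · have h1 := (abs_lt.1 (hnz hx0 hc)).2
        have h2 : l * h / e ≤ x := by
          rw [div_le_iff₀ he0]; linarith
        have h3 : (δ + l * h / e) ^ 2 ≤ 4 * x ^ 2 := by
          have : δ + l * h / e ≤ 2 * x := by linarith [hx.1]
          calc (δ + l * h / e) ^ 2 ≤ (2 * x) ^ 2 := by gcongr
            _ = 4 * x ^ 2 := by ring
        rw [div_le_div_iff₀ (by positivity) (by positivity)]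
        calc overlap h D (-e) x * (δ + l * h / e) ^ 2 ≤ h * (4 * x ^ 2) := by
              gcongr
              exact overlap_le hh.le _ _ _
          _ = 4 * h * x ^ 2 := by ring
    have key := setIntegral_le_const_mul
      (integrableOn_div_sq hδ (continuous_overlap h D (-e))) (by positivity)
      (a := (D - h) / e) (b := (D + h) / e) (by gcongr; linarith) hM (fun x hx hxa => by
        have hx0 : 0 < x := hδ.trans_le hx.1
        by_contra hc
        have h1 := abs_lt.1 (hnz hx0 hc)
        apply hxa
        constructor
        · rw [div_le_iff₀ he0]; linarith [h1.2]
        · rw [le_div_iff₀ he0]; linarith [h1.1])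
    refine key.trans ?_
    -- Bounding one factor of the square below by `e * (δ + l * h)` and the other by `l * h` removes
    -- the dependence on the slope difference.
    have e1 : 4 * h / (δ + l * h / e) ^ 2 * ((D + h) / e - (D - h) / e)
        = 8 * h ^ 2 * e / (δ * e + l * h) ^ 2 := by
      field_simp
      ring
    rw [e1, div_le_div_iff₀ (by positivity) (by positivity)]
    have h4 : e * (δ + l * h) ≤ δ * e + l * h := by nlinarith
    have h5 : l * h ≤ δ * e + l * h := by nlinarith
    have h6 : e * (δ + l * h) * (l * h) ≤ (δ * e + l * h) ^ 2 := by
      rw [sq]; gcongr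
    have h7 : e * (δ + l * h) * ((l + 1) * h) ≤ 2 * (δ * e + l * h) ^ 2 := by
      have : e * (δ + l * h) * ((l + 1) * h) ≤ e * (δ + l * h) * (2 * (l * h)) := by
        have : (l + 1) * h ≤ 2 * (l * h) := by nlinarith
        exact mul_le_mul_of_nonneg_left this (by positivity)
      linarith
    nlinarith

theorem sum_div_le_log {δ h : ℝ} (hδ : 0 < δ) (hh : 0 < h) (K : ℕ) :
    ∑ l ∈ Finset.range (K + 1), h / (δ + l * h) ≤ h / δ + Real.log (1 + K * h / δ) := by
  induction K with
  | zero => simp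
  | succ K ih =>
    rw [Finset.sum_range_succ]
    have h1 : 0 < δ + K * h := by positivity
    have h2 : 0 < δ + (K + 1) * h := by positivity
    have e : 1 + ((K + 1 : ℕ) : ℝ) * h / δ = (1 + K * h / δ) * ((δ + (K + 1) * h) / (δ + K * h)) := by
      push_cast
      field_simp
    rw [e, Real.log_mul (by positivity) (by positivity)]
    have h3 := Real.one_sub_inv_le_log_of_pos (div_pos h2 h1)
    have h4 : 1 - ((δ + (K + 1) * h) / (δ + K * h))⁻¹ = h / (δ + (K + 1) * h) := by
      field_simp; ring
    rw [h4] at h3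
    push_cast
    linarith

theorem sum_sum_range_add_le (M : ℕ) (F : ℕ → ℝ) (hF : ∀ l, 0 ≤ F l) :
    ∑ a ∈ Finset.range M, ∑ b ∈ Finset.range M, F (a + b) ≤
      ∑ l ∈ Finset.range (2 * M), (l + 1) * F l := by
  rw [← Finset.sum_product', ← Finset.sum_fiberwise_of_maps_to (t := Finset.range (2 * M))
    (g := fun p : ℕ × ℕ => p.1 + p.2)]
  · refine Finset.sum_le_sum fun l _ => ?_
    rw [Finset.sum_congr rfl fun p hp => by rw [(Finset.mem_filter.1 hp).2], Finset.sum_const,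
      nsmul_eq_mul]
    refine mul_le_mul_of_nonneg_right ?_ (hF l)
    have h : {p ∈ Finset.range M ×ˢ Finset.range M | p.1 + p.2 = l} ⊆
        Finset.HasAntidiagonal.antidiagonal l := by
      intro p hp
      exact Finset.HasAntidiagonal.mem_antidiagonal.2 (Finset.mem_filter.1 hp).2
    have := Finset.card_le_card h
    rw [Finset.Nat.card_antidiagonal] at this
    exact_mod_cast this
  · intro p hp
    rw [Finset.mem_product, Finset.mem_range, Finset.mem_range] at hp
    rw [Finset.mem_range]
    omega

/-! ### The energy of a sticky family -/

theorem energy_third (δ h D d : ℝ) : energy δ (h / 3) (D / 3) (d / 3) = energy δ h D d / 3 := by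
  unfold energy
  rw [← integral_div]
  refine setIntegral_congr_fun measurableSet_Icc fun x _ => ?_
  have : overlap (h / 3) (D / 3) (d / 3) x = overlap h D d x / 3 := by
    unfold overlap
    have e : D / 3 + x * (d / 3) = (D + x * d) / 3 := by ring
    rw [e, abs_div, abs_of_pos (by norm_num : (0 : ℝ) < 3), ← sub_div]
    nth_rewrite 1 [← zero_div (3 : ℝ)]
    exact max_div_div_right (by norm_num) _ _
  simp only [this]
  ring

theorem energy_neg (δ h D d : ℝ) : energy δ h (-D) (-d) = energy δ h D d := by
  unfold energy
  simp only [overlap_neg]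

/-- The energy of the pair of strips with addresses `v` and `w`. -/
noncomputable def StickyMap.pairEnergy (δ : ℝ) (n : ℕ) (ω : StickyMap n) (v w : TriadicIndex n) :
    ℝ :=
  energy δ (1 / 3 ^ n) (((w.pos n : ℝ) - v.pos n) / 3 ^ n) (ω.slope n w - ω.slope n v)

/-- The sum of the energies of all ordered pairs of strips, the diagonal included. It equals
`∫ ∫ f ^ 2 / x ^ 2` over `δ ≤ x ≤ 1`, where `f` counts the strips through a point. -/
noncomputable def StickyMap.totalEnergy (δ : ℝ) (n : ℕ) (ω : StickyMap n) : ℝ :=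
  ∑ v : TriadicIndex n, ∑ w : TriadicIndex n, ω.pairEnergy δ n v w

theorem StickyMap.pairEnergy_comm (δ : ℝ) (n : ℕ) (ω : StickyMap n) (v w : TriadicIndex n) :
    ω.pairEnergy δ n v w = ω.pairEnergy δ n w v := by
  unfold StickyMap.pairEnergy
  rw [← energy_neg]
  congr 1 <;> ring

theorem StickyMap.pairEnergy_same (δ : ℝ) (n : ℕ) (ω : StickyMap (n + 1)) (i : Fin 3)
    (v w : TriadicIndex n) :
    ω.pairEnergy δ (n + 1) (i, v) (i, w) = (ω i).2.pairEnergy δ n v w / 3 := by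
  unfold StickyMap.pairEnergy
  rw [← energy_third]
  simp only [TriadicIndex.pos, StickyMap.slope]
  congr 1
  · field_simp; ring
  · push_cast; field_simp; ring
  · ring

/-- The pairs of strips whose addresses differ in the first digit. For given first
digits, at most `l + 1` pairs are separated by exactly `l` intervals inside these two thirds of `[0, 1]`,
so the bound of `energy_le` sums to a harmonic sum. -/
theorem StickyMap.sum_pairEnergy_lt {δ : ℝ} (hδ : 0 < δ) (hδ1 : δ ≤ 1) (n : ℕ)
    (ω : StickyMap (n + 1)) {i j : Fin 3} (hij : i < j) :
    ∑ v : TriadicIndex n, ∑ w : TriadicIndex n, ω.pairEnergy δ (n + 1) (i, v) (j, w) ≤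
      16 * (1 / 3 ^ (n + 1) / δ + Real.log (1 + 1 / δ)) := by
  set h : ℝ := 1 / 3 ^ (n + 1) with hh
  have hh0 : 0 < h := by positivity
  set F : ℕ → ℝ := fun l => 16 * h / ((l + 1) * (δ + l * h)) with hF
  have hF0 (l : ℕ) : 0 ≤ F l := by positivity
  -- The argument of `F` is the number of intervals between `v` and the end of its third, plus the
  -- number between the start of the third of `w` and `w`.
  have h1 (v w : TriadicIndex n) : ω.pairEnergy δ (n + 1) (i, v) (j, w) ≤
      F (3 ^ n - 1 - v.pos n + w.pos n) := by
    refine energy_le hδ hδ1 hh0 _ ?_ ?_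
    · have hv := v.pos_lt n
      have hij' : (i : ℕ) + 1 ≤ j := hij
      have hnat : (3 ^ n - 1 - v.pos n + w.pos n) + 1 + TriadicIndex.pos (n + 1) (i, v)
          ≤ TriadicIndex.pos (n + 1) (j, w) := by
        have := Nat.mul_le_mul_right (3 ^ n) hij'
        simp only [TriadicIndex.pos]
        rw [Nat.succ_mul] at this
        omega
      have hreal : ((3 ^ n - 1 - v.pos n + w.pos n : ℕ) : ℝ) + 1
          ≤ (TriadicIndex.pos (n + 1) (j, w) : ℝ) - TriadicIndex.pos (n + 1) (i, v) := by
        rw [le_sub_iff_add_le]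
        exact_mod_cast hnat
      rw [div_eq_mul_one_div, ← hh]
      gcongr
    · have h2 := ω.slope_mem_Icc (n + 1) (i, v)
      have h3 := ω.slope_mem_Icc (n + 1) (j, w)
      rw [abs_le]
      constructor <;> linarith [h2.1, h2.2, h3.1, h3.2]
  have h2 : ∑ v : TriadicIndex n, ∑ w : TriadicIndex n, F (3 ^ n - 1 - v.pos n + w.pos n)
      = ∑ a ∈ Finset.range (3 ^ n), ∑ b ∈ Finset.range (3 ^ n), F (a + b) := by
    rw [TriadicIndex.sum_pos n fun a => ∑ w : TriadicIndex n, F (3 ^ n - 1 - a + w.pos n),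
      Finset.sum_range_reflect (fun a => ∑ w : TriadicIndex n, F (a + w.pos n))]
    exact Finset.sum_congr rfl fun a _ => TriadicIndex.sum_pos n fun b => F (a + b)
  have h3 : ∑ l ∈ Finset.range (2 * 3 ^ n), ((l : ℝ) + 1) * F l
      ≤ 16 * (h / δ + Real.log (1 + 1 / δ)) := by
    have e (l : ℕ) : ((l : ℝ) + 1) * F l = 16 * (h / (δ + l * h)) := by
      simp only [hF]; field_simp
    rw [Finset.sum_congr rfl fun l _ => e l, ← Finset.mul_sum]
    refine mul_le_mul_of_nonneg_left ?_ (by norm_num)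
    have h4 := sum_div_le_log hδ hh0 (2 * 3 ^ n)
    rw [Finset.sum_range_succ] at h4
    have h5 : (0 : ℝ) ≤ h / (δ + (2 * 3 ^ n : ℕ) * h) := by positivity
    have h6 : ((2 * 3 ^ n : ℕ) : ℝ) * h ≤ 1 := by
      have : ((2 * 3 ^ n : ℕ) : ℝ) * h = 2 / 3 := by
        rw [hh]; push_cast; field_simp; ring
      rw [this]; norm_num
    have h7 : Real.log (1 + (2 * 3 ^ n : ℕ) * h / δ) ≤ Real.log (1 + 1 / δ) := by
      gcongr
    linarith
  calc _ ≤ ∑ v : TriadicIndex n, ∑ w : TriadicIndex n, F (3 ^ n - 1 - v.pos n + w.pos n) :=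
        Finset.sum_le_sum fun v _ => Finset.sum_le_sum fun w _ => h1 v w
    _ ≤ _ := by rw [h2]; exact (sum_sum_range_add_le _ F hF0).trans h3

theorem StickyMap.sum_pairEnergy_ne {δ : ℝ} (hδ : 0 < δ) (hδ1 : δ ≤ 1) (n : ℕ)
    (ω : StickyMap (n + 1)) {i j : Fin 3} (hij : i ≠ j) :
    ∑ v : TriadicIndex n, ∑ w : TriadicIndex n, ω.pairEnergy δ (n + 1) (i, v) (j, w) ≤
      16 * (1 / 3 ^ (n + 1) / δ + Real.log (1 + 1 / δ)) := by
  rcases lt_or_gt_of_ne hij with h | h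
  · exact ω.sum_pairEnergy_lt hδ hδ1 n h
  · rw [Finset.sum_comm]
    refine le_of_eq_of_le ?_ (ω.sum_pairEnergy_lt hδ hδ1 n h)
    exact Finset.sum_congr rfl fun w _ => Finset.sum_congr rfl fun v _ =>
      ω.pairEnergy_comm δ (n + 1) (i, v) (j, w)

/-- Pairs with equal first digits reproduce the energy of depth `n`: three copies, each scaled by
`1 / 3`. Hence every level of the tree contributes at most `O(log (1 / δ))`, for every sticky map. -/
theorem StickyMap.totalEnergy_le {δ : ℝ} (hδ : 0 < δ) (hδ1 : δ ≤ 1) (n : ℕ) (ω : StickyMap n) :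
    ω.totalEnergy δ n ≤ (49 - 48 / 3 ^ n) / δ + 96 * n * Real.log (1 + 1 / δ) := by
  induction n with
  | zero =>
    have h1 : ω.totalEnergy δ 0 = ∑ v : Unit, ∑ w : Unit, energy δ (1 / 3 ^ 0) ((0 - 0) / 3 ^ 0) (0 - 0) := by
      unfold StickyMap.totalEnergy StickyMap.pairEnergy
      simp only [TriadicIndex.pos, StickyMap.slope, Nat.cast_zero]
      rfl
    rw [h1]
    have := energy_le_trivial hδ hδ1 zero_le_one 0 0
    simpa using (by norm_num; simpa using this)
  | succ n ih =>
    set L := Real.log (1 + 1 / δ) with hL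
    set B := 16 * (1 / 3 ^ (n + 1) / δ + L) with hB
    set A := (49 - 48 / 3 ^ n) / δ + 96 * n * L with hA
    have hij (i j : Fin 3) : ∑ v : TriadicIndex n, ∑ w : TriadicIndex n,
        ω.pairEnergy δ (n + 1) (i, v) (j, w) ≤ if i = j then A / 3 else B := by
      split_ifs with h
      · subst h
        simp_rw [ω.pairEnergy_same, ← Finset.sum_div]
        have := ih (ω i).2
        unfold StickyMap.totalEnergy at this
        gcongr
      · exact ω.sum_pairEnergy_ne hδ hδ1 n h
    have h1 : ω.totalEnergy δ (n + 1) = ∑ i : Fin 3, ∑ j : Fin 3, ∑ v : TriadicIndex n,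
        ∑ w : TriadicIndex n, ω.pairEnergy δ (n + 1) (i, v) (j, w) := by
      unfold StickyMap.totalEnergy
      rw [TriadicIndex.sum_succ]
      refine Finset.sum_congr rfl fun i _ => ?_
      refine Eq.trans ?_ Finset.sum_comm
      exact Finset.sum_congr rfl fun v _ =>
        TriadicIndex.sum_succ n fun w => ω.pairEnergy δ (n + 1) (i, v) w
    have h2 : ∑ i : Fin 3, ∑ j : Fin 3, (if i = j then A / 3 else B) = A + 6 * B := by
      simp [Fin.sum_univ_three]
      ring
    rw [h1]
    refine (Finset.sum_le_sum fun i _ => Finset.sum_le_sum fun j _ => hij i j).trans ?_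
    rw [h2, hA, hB]
    -- `48 / 3 ^ n - 48 / 3 ^ (n + 1) = 6 * 16 / 3 ^ (n + 1)` absorbs the first summand of `6 * B`.
    refine le_of_eq ?_
    push_cast
    field_simp
    ring

theorem integral_indicator_mul_indicator_Icc {h : ℝ} (a b : ℝ) :
    ∫ y, (Set.Icc a (a + h)).indicator (1 : ℝ → ℝ) y * (Set.Icc b (b + h)).indicator 1 y
      = max 0 (h - |b - a|) := by
  have e (y : ℝ) : (Set.Icc a (a + h)).indicator (1 : ℝ → ℝ) y * (Set.Icc b (b + h)).indicator 1 y
      = (Set.Icc a (a + h) ∩ Set.Icc b (b + h)).indicator 1 y := by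
    rw [Set.inter_indicator_one]; rfl
  simp_rw [e]
  rw [integral_indicator_one (measurableSet_Icc.inter measurableSet_Icc), Set.Icc_inter_Icc,
    Real.volume_real_Icc, max_comm, min_add_add_right]
  congr 1
  rw [abs_sub_comm, ← max_sub_min_eq_abs' a b]
  ring

/-- The Cauchy–Schwarz inequality on a vertical slice, in the form `2 f ≤ μ 1_U + f ^ 2 / μ`, where `f`
counts the strips through a point. The integral of `f` over a slice is `1`. -/
theorem StickyMap.two_le_slice (n : ℕ) (ω : StickyMap n) (x : ℝ) {μ : ℝ} (hμ : 0 < μ) :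
    2 ≤ μ * volume.real (ω.slice n x) + (∑ v : TriadicIndex n, ∑ w : TriadicIndex n,
      overlap (1 / 3 ^ n) (((w.pos n : ℝ) - v.pos n) / 3 ^ n) (ω.slope n w - ω.slope n v) x) / μ := by
  set h : ℝ := 1 / 3 ^ n with hh
  have hh0 : 0 < h := by positivity
  let a : TriadicIndex n → ℝ := fun v => (v.pos n : ℝ) / 3 ^ n + x * ω.slope n v
  let I : TriadicIndex n → ℝ → ℝ := fun v => (Set.Icc (a v) (a v + h)).indicator 1
  have hU : ω.slice n x = ⋃ v, Set.Icc (a v) (a v + h) := by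
    rw [ω.slice_eq_iUnion]
    refine Set.iUnion_congr fun v => ?_
    simp only [a, hh]
    congr 1
    ring
  have hfin : volume (ω.slice n x) < ⊤ := by
    rw [hU]
    exact (isCompact_iUnion fun v => isCompact_Icc).measure_lt_top
  have hI (v) : Integrable (I v) :=
    (integrable_indicator_iff measurableSet_Icc).2
      (integrableOn_const isCompact_Icc.measure_lt_top.ne)
  have hII (v w) : Integrable fun y => I v y * I w y := by
    have e : (fun y => I v y * I w y) =
        (Set.Icc (a v) (a v + h) ∩ Set.Icc (a w) (a w + h)).indicator 1 := by
      rw [Set.inter_indicator_one]; rfl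
    rw [e, integrable_indicator_iff (measurableSet_Icc.inter measurableSet_Icc), Set.Icc_inter_Icc]
    exact integrableOn_const isCompact_Icc.measure_lt_top.ne
  have hUi : Integrable ((ω.slice n x).indicator (1 : ℝ → ℝ)) :=
    (integrable_indicator_iff (ω.measurableSet_slice n x)).2 (integrableOn_const hfin.ne)
  have hpt (y : ℝ) : 2 * ∑ v, I v y ≤
      μ * (ω.slice n x).indicator 1 y + (∑ v, ∑ w, I v y * I w y) / μ := by
    rw [← Finset.sum_mul_sum]
    by_cases hy : y ∈ ω.slice n x
    · rw [Set.indicator_of_mem hy]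
      set f := ∑ v, I v y
      have e : μ * (1 : ℝ → ℝ) y + f * f / μ - 2 * f = (μ - f) ^ 2 / μ := by
        simp only [Pi.one_apply]
        field_simp; ring
      have : 0 ≤ (μ - f) ^ 2 / μ := by positivity
      linarith
    · have h0 : ∑ v, I v y = 0 := by
        refine Finset.sum_eq_zero fun v _ => Set.indicator_of_notMem (fun hv => hy ?_) _
        rw [hU]
        exact Set.mem_iUnion.2 ⟨v, hv⟩
      rw [h0, Set.indicator_of_notMem hy]
      simp
  have hint := integral_mono ((integrable_finsetSum _ fun v _ => hI v).const_mul 2)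
    ((hUi.const_mul μ).add ((integrable_finsetSum _ fun v _ =>
      integrable_finsetSum _ fun w _ => hII v w).div_const μ)) hpt
  have e1 : ∫ y, 2 * ∑ v, I v y = 2 := by
    have hv (v) : ∫ y, I v y = h := by
      rw [integral_indicator_one measurableSet_Icc, Real.volume_real_Icc_of_le (by linarith)]
      ring
    rw [integral_const_mul, integral_finsetSum _ fun v _ => hI v,
      Finset.sum_congr rfl fun v _ => hv v, Finset.sum_const, Finset.card_univ,
      TriadicIndex.card, hh]
    simp
  have e2 : ∫ y, (μ * (ω.slice n x).indicator 1 y + (∑ v, ∑ w, I v y * I w y) / μ)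
      = μ * volume.real (ω.slice n x) + (∑ v : TriadicIndex n, ∑ w : TriadicIndex n,
      overlap h (((w.pos n : ℝ) - v.pos n) / 3 ^ n) (ω.slope n w - ω.slope n v) x) / μ := by
    rw [integral_add (hUi.const_mul μ) ((integrable_finsetSum _ fun v _ =>
      integrable_finsetSum _ fun w _ => hII v w).div_const μ), integral_const_mul,
      integral_indicator_one (ω.measurableSet_slice n x), integral_div,
      integral_finsetSum _ fun v _ => integrable_finsetSum _ fun w _ => hII v w]
    congr 2
    refine Finset.sum_congr rfl fun v _ => ?_
    rw [integral_finsetSum _ fun w _ => hII v w]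
    refine Finset.sum_congr rfl fun w _ => ?_
    simp only [I]
    rw [integral_indicator_mul_indicator_Icc, overlap]
    congr 3
    simp only [a]
    ring
  rw [e1] at hint
  exact hint.trans_eq e2

theorem integral_inv_Icc {δ : ℝ} (hδ : 0 < δ) (hδ1 : δ ≤ 1) :
    ∫ x in Set.Icc δ 1, 1 / x = Real.log (1 / δ) := by
  rw [integral_Icc_eq_integral_Ioc, ← intervalIntegral.integral_of_le hδ1]
  exact integral_one_div_of_pos hδ one_pos

theorem ofReal_integral_le_lintegral {α : Type*} [MeasurableSpace α] {m : Measure α} {f : α → ℝ}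
    (hf : Integrable f m) : ENNReal.ofReal (∫ x, f x ∂m) ≤ ∫⁻ x, ENNReal.ofReal (f x) ∂m := by
  rw [integral_eq_lintegral_pos_part_sub_lintegral_neg_part hf]
  refine le_trans (ENNReal.ofReal_le_ofReal ?_) ENNReal.ofReal_toReal_le
  linarith [ENNReal.toReal_nonneg (a := ∫⁻ x, ENNReal.ofReal (-f x) ∂m)]

/-- The Cauchy–Schwarz inequality with weight `1 / x`: `(∫ ∫ f / x) ^ 2 ≤ |U| * ∫ ∫ f ^ 2 / x ^ 2`. -/
theorem StickyMap.le_lintegral_slice {δ A : ℝ} (hδ : 0 < δ) (hδ1 : δ < 1) (n : ℕ) (ω : StickyMap n)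
    (hA : ω.totalEnergy δ n ≤ A) (hA0 : 0 < A) :
    ENNReal.ofReal (Real.log (1 / δ) ^ 2 / A) ≤ ∫⁻ x in Set.Icc δ 1, volume (ω.slice n x) := by
  set L := Real.log (1 / δ) with hL
  have hL0 : 0 < L := Real.log_pos (by rw [lt_div_iff₀ hδ]; linarith)
  -- The multiplier that optimizes `two_le_slice` (used with `μ = l * x`) after integration.
  set l := A / L with hl
  have hl0 : 0 < l := by positivity
  set g : ℝ → ℝ := fun x => ∑ v : TriadicIndex n, ∑ w : TriadicIndex n,
      overlap (1 / 3 ^ n) (((w.pos n : ℝ) - v.pos n) / 3 ^ n) (ω.slope n w - ω.slope n v) x with hg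
  have hgc : Continuous g := by
    refine continuous_finsetSum _ fun v _ => continuous_finsetSum _ fun w _ => ?_
    exact continuous_overlap _ _ _
  have hov (v w : TriadicIndex n) := integrableOn_div_sq hδ
    (continuous_overlap (1 / 3 ^ n) (((w.pos n : ℝ) - v.pos n) / 3 ^ n)
      (ω.slope n w - ω.slope n v))
  have hgi : ∫ x in Set.Icc δ 1, g x / x ^ 2 = ω.totalEnergy δ n := by
    simp only [hg, Finset.sum_div]
    rw [integral_finsetSum _ fun v _ => integrable_finsetSum _ fun w _ => hov v w]
    refine Finset.sum_congr rfl fun v _ => ?_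
    rw [integral_finsetSum _ fun w _ => hov v w]
    rfl
  have hinv : IntegrableOn (fun x : ℝ => 1 / x) (Set.Icc δ 1) := by
    refine ContinuousOn.integrableOn_Icc ?_
    refine continuousOn_const.div (by fun_prop) fun x hx => ?_
    exact (hδ.trans_le hx.1).ne'
  have hi1 : IntegrableOn (fun x : ℝ => 2 / l * (1 / x)) (Set.Icc δ 1) := hinv.const_mul _
  have hi2 : IntegrableOn (fun x : ℝ => (1 / l ^ 2) * (g x / x ^ 2)) (Set.Icc δ 1) :=
    (integrableOn_div_sq hδ hgc).const_mul _
  have hval : ∫ x in Set.Icc δ 1, (2 / l * (1 / x) - (1 / l ^ 2) * (g x / x ^ 2))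
      = 2 / l * L - (1 / l ^ 2) * ω.totalEnergy δ n := by
    rw [integral_sub hi1 hi2, integral_const_mul, integral_const_mul, hgi,
      integral_inv_Icc hδ hδ1.le]
  have h1 : L ^ 2 / A ≤ 2 / l * L - (1 / l ^ 2) * ω.totalEnergy δ n := by
    have h2 : (1 / l ^ 2) * ω.totalEnergy δ n ≤ (1 / l ^ 2) * A := by gcongr
    have h3 : 2 / l * L - (1 / l ^ 2) * A = L ^ 2 / A := by
      rw [hl]; field_simp; ring
    linarith
  calc ENNReal.ofReal (L ^ 2 / A)
      ≤ ENNReal.ofReal (∫ x in Set.Icc δ 1, (2 / l * (1 / x) - (1 / l ^ 2) * (g x / x ^ 2))) := by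
        rw [hval]; exact ENNReal.ofReal_le_ofReal h1
    _ ≤ ∫⁻ x in Set.Icc δ 1, ENNReal.ofReal (2 / l * (1 / x) - (1 / l ^ 2) * (g x / x ^ 2)) :=
        ofReal_integral_le_lintegral (Integrable.sub hi1 hi2)
    _ ≤ ∫⁻ x in Set.Icc δ 1, volume (ω.slice n x) := by
        refine setLIntegral_mono' measurableSet_Icc fun x hx => ?_
        have hx0 : 0 < x := hδ.trans_le hx.1
        refine (ENNReal.ofReal_le_ofReal ?_).trans ENNReal.ofReal_toReal_le
        have h2 := ω.two_le_slice n x (mul_pos hl0 hx0)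
        have h3 : 2 / l * (1 / x) ≤ volume.real (ω.slice n x) + (1 / l ^ 2) * (g x / x ^ 2) := by
          have e1 : 2 / l * (1 / x) = 2 / (l * x) := by field_simp
          have e2 : volume.real (ω.slice n x) + (1 / l ^ 2) * (g x / x ^ 2)
              = (l * x * volume.real (ω.slice n x) + g x / (l * x)) / (l * x) := by
            field_simp
          rw [e1, e2]
          gcongr
        have h4 : 2 / l * (1 / x) - (1 / l ^ 2) * (g x / x ^ 2) ≤ volume.real (ω.slice n x) := by
          linarith
        exact h4

/-- For every sticky map, the strips over `0 ≤ x ≤ 1` cover an area of order at least `log n / n`. -/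
theorem StickyMap.log_div_le_lintegral_slice {n : ℕ} (hn : 1 ≤ n) (ω : StickyMap n) :
    ENNReal.ofReal (Real.log (2 * n) / (340 * n)) ≤
      ∫⁻ x in Set.Icc 0 1, volume (ω.slice n x) := by
  have hn1 : (1 : ℝ) ≤ n := by exact_mod_cast hn
  -- With this cutoff the near-diagonal part `O(1 / δ)` of the energy is of order `n`; the factor `2`
  -- keeps `log (1 / δ)` positive for `n = 1`.
  set δ : ℝ := 1 / (2 * n) with hδ
  have hδ0 : 0 < δ := by positivity
  have hδ1 : δ < 1 := by
    rw [hδ, div_lt_one (by positivity)]; linarith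
  have hinv : 1 / δ = 2 * n := by rw [hδ]; field_simp
  set L := Real.log (2 * n) with hL
  have hL2 : 0.69 ≤ L := by
    have : Real.log 2 ≤ L := Real.log_le_log (by norm_num) (by linarith)
    linarith [Real.log_two_gt_d9]
  have hA : ω.totalEnergy δ n ≤ 340 * n * L := by
    have h1 := ω.totalEnergy_le hδ0 hδ1.le n
    have h2 : (49 - 48 / 3 ^ n) / δ ≤ 98 * n := by
      rw [div_eq_mul_one_div, hinv]
      have : (0 : ℝ) ≤ 48 / 3 ^ n := by positivity
      nlinarith
    have h3 : Real.log (1 + 1 / δ) ≤ 2 * L := by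
      rw [hinv, hL, ← Real.log_rpow (by positivity)]
      refine Real.log_le_log (by positivity) ?_
      norm_num
      nlinarith
    have h4 : 96 * n * Real.log (1 + 1 / δ) ≤ 96 * n * (2 * L) := by gcongr
    nlinarith
  have h5 := ω.le_lintegral_slice hδ0 hδ1 n hA (by positivity)
  rw [hinv] at h5
  have h6 : L ^ 2 / (340 * n * L) = L / (340 * n) := by
    field_simp
  rw [h6] at h5
  exact h5.trans (lintegral_mono_set (Set.Icc_subset_Icc_left hδ0.le))

/-! ### Thin parallelograms in the plane -/

/-- Fubini in the Euclidean plane, by vertical slices. -/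
theorem volume_plane {A : Set Plane} (hA : MeasurableSet A) :
    volume A = ∫⁻ x : ℝ, volume {y : ℝ | (!₂[x, y] : Plane) ∈ A} := by
  have h1 : MeasurePreserving (fun p : ℝ × ℝ => (WithLp.toLp 2 ![p.1, p.2] : Plane)) :=
    (PiLp.volume_preserving_toLp (Fin 2)).comp (volume_preserving_finTwoArrow ℝ).symm
  rw [← h1.measure_preimage hA.nullMeasurableSet, Measure.volume_eq_prod,
    Measure.prod_apply (h1.measurable hA)]
  rfl

theorem measurable_volume_slice (n : ℕ) (ω : StickyMap n) :
    Measurable fun x => volume (ω.slice n x) := by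
  have h : MeasurableSet {p : ℝ × ℝ | p.2 ∈ ω.slice n p.1} := by
    have e : {p : ℝ × ℝ | p.2 ∈ ω.slice n p.1} = ⋃ v : TriadicIndex n,
        {p : ℝ × ℝ | (v.pos n : ℝ) / 3 ^ n ≤ p.2 - p.1 * ω.slope n v} ∩
          {p : ℝ × ℝ | p.2 - p.1 * ω.slope n v ≤ (v.pos n + 1) / 3 ^ n} := by
      ext p
      simp only [Set.mem_iUnion]
      rfl
    rw [e]
    refine MeasurableSet.iUnion fun v => ?_
    exact (measurableSet_le (by fun_prop) (by fun_prop)).inter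
      (measurableSet_le (by fun_prop) (by fun_prop))
  exact measurable_measure_prodMk_left h

theorem linearIndependent_of_first_coord {u : ℝ} (s : ℝ) {h : ℝ} (hu : u ≠ 0) (hh : h ≠ 0) :
    LinearIndependent ℝ ![(!₂[u, u * s] : Plane), !₂[0, h]] := by
  rw [LinearIndependent.pair_iff]
  intro a b hab
  have h0 := congrArg (fun p : Plane => p 0) hab
  have h1 := congrArg (fun p : Plane => p 1) hab
  simp at h0 h1
  have ha : a = 0 := by tauto
  subst ha
  simp at h1
  exact ⟨rfl, by tauto⟩

/-- The part of the strip `t ≤ y - x * s ≤ t + h` over `2 ≤ x ≤ 6`. The abscissas are chosen so that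
its double reaches back to the axis `x = 0`, from which the strips emanate. -/
noncomputable def thinParallelogram (t s h : ℝ) (hh : 0 < h) (hh1 : h ≤ 1) : Parallelogram where
  base := !₂[2, t + 2 * s]
  longSide := !₂[4, 4 * s]
  shortSide := !₂[0, h]
  linearIndependent := linearIndependent_of_first_coord s (by norm_num) hh.ne'
  short_lt_long := by
    rw [EuclideanSpace.norm_eq, EuclideanSpace.norm_eq]
    refine Real.sqrt_lt_sqrt (by positivity) ?_
    simp [Fin.sum_univ_two]
    nlinarith [sq_nonneg s]

section

variable {t s h : ℝ} (hh : 0 < h) (hh1 : h ≤ 1)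

theorem mem_carrier_thinParallelogram (p : Plane) :
    p ∈ (thinParallelogram t s h hh hh1).carrier ↔
      p 0 ∈ Set.Icc 2 6 ∧ t ≤ p 1 - p 0 * s ∧ p 1 - p 0 * s ≤ t + h := by
  constructor
  · rintro ⟨a, ⟨ha0, ha1⟩, b, ⟨hb0, hb1⟩, rfl⟩
    simp [thinParallelogram]
    refine ⟨⟨by linarith, by linarith⟩, by nlinarith, by nlinarith⟩
  · rintro ⟨⟨h1, h2⟩, h3, h4⟩
    refine ⟨(p 0 - 2) / 4, ⟨by linarith, by linarith⟩, (p 1 - p 0 * s - t) / h,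
      ⟨div_nonneg (by linarith) hh.le, (div_le_one hh).2 (by linarith)⟩, ?_⟩
    ext i
    fin_cases i
    · simp [thinParallelogram]
    · simp [thinParallelogram]
      field_simp
      ring

theorem mem_double_thinParallelogram {p : Plane} (h0 : p 0 ∈ Set.Icc (0 : ℝ) 1)
    (h1 : t ≤ p 1 - p 0 * s) (h2 : p 1 - p 0 * s ≤ t + h) :
    p ∈ (thinParallelogram t s h hh hh1).double := by
  set c := (thinParallelogram t s h hh hh1).center with hc
  have hc0 : c 0 = 4 := by
    simp [hc, Parallelogram.center, thinParallelogram]; norm_num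
  have hc1 : c 1 = t + 4 * s + h / 2 := by
    simp [hc, Parallelogram.center, thinParallelogram]; ring
  refine ⟨(1 / 2 : ℝ) • (p + c), ?_, ?_⟩
  · rw [mem_carrier_thinParallelogram]
    simp only [PiLp.smul_apply, PiLp.add_apply, smul_eq_mul, hc0, hc1]
    exact ⟨⟨by linarith [h0.1], by linarith [h0.2]⟩, by linarith, by linarith⟩
  · rw [AffineMap.homothety_apply]
    simp only [vsub_eq_sub, vadd_eq_add]
    module

theorem isCompact_carrier (P : Parallelogram) : IsCompact P.carrier := by
  have : P.carrier = (fun q : ℝ × ℝ => P.base + q.1 • P.longSide + q.2 • P.shortSide) ''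
      (Set.Icc 0 1 ×ˢ Set.Icc 0 1) := by
    ext x
    constructor
    · rintro ⟨a, ha, b, hb, rfl⟩
      exact ⟨(a, b), ⟨ha, hb⟩, rfl⟩
    · rintro ⟨⟨a, b⟩, ⟨ha, hb⟩, rfl⟩
      exact ⟨a, ha, b, hb, rfl⟩
  rw [this]
  exact (isCompact_Icc.prod isCompact_Icc).image (by fun_prop)

theorem isCompact_double (P : Parallelogram) : IsCompact P.double :=
  (isCompact_carrier P).image (AffineMap.homothety_continuous _ _)

theorem volume_carrier_thinParallelogram :
    volume (thinParallelogram t s h hh hh1).carrier = ENNReal.ofReal (4 * h) := by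
  rw [volume_plane (isCompact_carrier _).measurableSet]
  have e (x : ℝ) : volume {y : ℝ | (!₂[x, y] : Plane) ∈ (thinParallelogram t s h hh hh1).carrier}
      = (Set.Icc 2 6).indicator (fun _ => ENNReal.ofReal h) x := by
    by_cases hx : x ∈ Set.Icc 2 6
    · rw [Set.indicator_of_mem hx]
      have : {y : ℝ | (!₂[x, y] : Plane) ∈ (thinParallelogram t s h hh hh1).carrier}
          = Set.Icc (t + x * s) (t + h + x * s) := by
        ext y
        rw [Set.mem_ofPred_eq, mem_carrier_thinParallelogram]
        change (x ∈ Set.Icc 2 6 ∧ t ≤ y - x * s ∧ y - x * s ≤ t + h) ↔ _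
        rw [and_iff_right hx, Set.mem_Icc]
        constructor <;> rintro ⟨h1, h2⟩ <;> constructor <;> linarith
      rw [this, Real.volume_Icc]
      congr 1; ring
    · rw [Set.indicator_of_notMem hx]
      have : {y : ℝ | (!₂[x, y] : Plane) ∈ (thinParallelogram t s h hh hh1).carrier} = ∅ := by
        ext y
        simp only [Set.mem_ofPred_eq, mem_carrier_thinParallelogram, Set.mem_empty_iff_false,
          iff_false, not_and]
        intro h0
        exact absurd h0 hx
      rw [this, measure_empty]
  simp_rw [e]
  rw [lintegral_indicator measurableSet_Icc, setLIntegral_const, Real.volume_Icc,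
    mul_comm, ← ENNReal.ofReal_mul (by norm_num)]
  norm_num

theorem norm_shortSide_thinParallelogram : ‖(thinParallelogram t s h hh hh1).shortSide‖ = h := by
  simp [thinParallelogram, EuclideanSpace.norm_eq, Fin.sum_univ_two, Real.sqrt_sq hh.le]

theorem norm_longSide_thinParallelogram (hs : s ∈ Set.Icc (0 : ℝ) 1) :
    ‖(thinParallelogram t s h hh hh1).longSide‖ ∈ Set.Icc 4 8 := by
  obtain ⟨h0, h1⟩ := hs
  rw [EuclideanSpace.norm_eq]
  simp only [thinParallelogram, Fin.sum_univ_two]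
  constructor
  · refine Real.le_sqrt_of_sq_le ?_
    simp
  · rw [Real.sqrt_le_left (by norm_num)]
    simp [abs_of_nonneg h0]
    nlinarith

theorem width_thinParallelogram (hs : s ∈ Set.Icc (0 : ℝ) 1) :
    (thinParallelogram t s h hh hh1).width ∈ Set.Icc (h / 2) h := by
  constructor
  · unfold Parallelogram.width
    rw [Metric.le_infDist ⟨0, Submodule.zero_mem _⟩]
    intro q hq
    obtain ⟨r, rfl⟩ := Submodule.mem_span_singleton.1 hq
    rw [EuclideanSpace.dist_eq]
    refine Real.le_sqrt_of_sq_le ?_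
    simp [thinParallelogram, Fin.sum_univ_two, Real.dist_eq, sq_abs]
    obtain ⟨h0, h1⟩ := hs
    -- Either `|r * 4| ≥ h / 2` or `|h - r * 4 * s| ≥ h / 2`, since `s ≤ 1`.
    have h2 : (r * (4 * s)) ^ 2 ≤ (r * 4) ^ 2 := by
      have : s ^ 2 ≤ 1 := by nlinarith
      nlinarith [mul_nonneg (sq_nonneg r) (sub_nonneg.2 this)]
    nlinarith [sq_nonneg (h - 2 * (r * (4 * s)))]
  · have h1 := Metric.infDist_le_dist_of_mem (x := (thinParallelogram t s h hh hh1).shortSide)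
      (Submodule.zero_mem (Submodule.span ℝ {(thinParallelogram t s h hh hh1).longSide}))
    rw [dist_zero_right, norm_shortSide_thinParallelogram] at h1
    exact h1

/-- The left and right sides determine the base point. -/
theorem eq_of_carrier_thinParallelogram_eq {t' s' : ℝ}
    (e : (thinParallelogram t s h hh hh1).carrier = (thinParallelogram t' s' h hh hh1).carrier) :
    t = t' := by
  have key (x : ℝ) (hx : x ∈ Set.Icc (2 : ℝ) 6) : t + x * s = t' + x * s' := by
    have h1 (y : ℝ) : (t ≤ y - x * s ∧ y - x * s ≤ t + h) ↔
        (t' ≤ y - x * s' ∧ y - x * s' ≤ t' + h) := by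
      have := Set.ext_iff.1 e (!₂[x, y])
      simp only [mem_carrier_thinParallelogram] at this
      simpa [hx.1, hx.2] using this
    have h2 := (h1 (t + x * s)).1 ⟨by linarith, by linarith⟩
    have h3 := (h1 (t' + x * s')).2 ⟨by linarith, by linarith⟩
    linarith
  have h2 := key 2 ⟨by norm_num, by norm_num⟩
  have h6 := key 6 ⟨by norm_num, by norm_num⟩
  linarith

end

/-- A finite family whose average is at most `C` has a member that is at most `C`. -/
theorem exists_le_of_sum_le_card_mul {ι : Type*} [Fintype ι] [Nonempty ι] (f : ι → ENNReal) (C : ENNReal)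
    (h : ∑ i, f i ≤ Fintype.card ι * C) : ∃ i, f i ≤ C := by
  obtain ⟨i, _, hi⟩ := ENNReal.exists_le_of_sum_le (s := Finset.univ) Finset.univ_nonempty
    (f := f) (g := fun _ => C) (by simpa using h)
  exact ⟨i, hi⟩

/-- Some sticky map does as well as the average of `sum_volume_slice_le` over `2 ≤ x ≤ 6`. -/
theorem exists_stickyMap_lintegral_slice_le (n : ℕ) :
    ∃ ω : StickyMap n, ∫⁻ x in Set.Icc 2 6, volume (ω.slice n x) ≤
      ENNReal.ofReal (112 / (n + 1)) := by
  refine exists_le_of_sum_le_card_mul _ _ ?_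
  rw [← lintegral_finsetSum _ fun ω _ => measurable_volume_slice n ω]
  calc ∫⁻ x in Set.Icc 2 6, ∑ ω : StickyMap n, volume (ω.slice n x)
      ≤ ∫⁻ x in Set.Icc (2 : ℝ) 6,
          Fintype.card (StickyMap n) * ENNReal.ofReal (28 / (n + 1)) := by
        refine setLIntegral_mono' measurableSet_Icc fun x hx => ?_
        refine (sum_volume_slice_le n (by linarith [hx.1])).trans ?_
        gcongr
        linarith [hx.2]
    _ = Fintype.card (StickyMap n) * ENNReal.ofReal (112 / (n + 1)) := by
        rw [setLIntegral_const, Real.volume_Icc, mul_assoc, ← ENNReal.ofReal_mul (by positivity)]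
        congr 2
        ring

theorem theorem0p1 :
    ∃ c C : ℝ, 0 < c ∧ 0 < C ∧
      ∀ n N : ℕ, 1 ≤ n → N = 3 ^ n →
        ∃ P : Fin N → Parallelogram,
          Function.Injective (fun j => (P j).carrier) ∧
          (∀ j,
            (c * N ≤ (P j).eccentricity ∧ (P j).eccentricity ≤ C * N) ∧
            (c * N ≤ (P j).widthEccentricity ∧ (P j).widthEccentricity ≤ C * N) ∧
            (ENNReal.ofReal (c / N) ≤ volume (P j).carrier ∧
              volume (P j).carrier ≤ ENNReal.ofReal (C / N)) ∧
            (P j).LongSlopeMem cantorSet) ∧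
          volume (⋃ j, (P j).carrier) ≤ ENNReal.ofReal (C / Real.log N) ∧
          ENNReal.ofReal (c * (Real.log (Real.log N) / Real.log N)) ≤
            volume (⋃ j, (P j).double) := by
  refine ⟨1 / 340, 224, by norm_num, by norm_num, ?_⟩
  intro n N hn hN
  have hn1 : (1 : ℝ) ≤ n := by exact_mod_cast hn
  have hNr : (N : ℝ) = 3 ^ n := by rw [hN]; push_cast; rfl
  have hN0 : (0 : ℝ) < N := by rw [hNr]; positivity
  have hN1 : (1 : ℝ) ≤ N := by rw [hNr]; exact one_le_pow₀ (by norm_num)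
  have hh : (0 : ℝ) < 1 / N := by positivity
  have hh1 : (1 : ℝ) / N ≤ 1 := by rw [div_le_one hN0]; exact hN1
  -- Only `1 ≤ log 3 ≤ 2` is used, to compare `log N` with `n` and `log (log N)` with `log (2 * n)`.
  have hlog3 : 1 ≤ Real.log 3 := by
    rw [Real.le_log_iff_exp_le (by norm_num)]
    linarith [Real.exp_one_lt_d9]
  have hlog3' : Real.log 3 ≤ 2 := by
    linarith [Real.log_le_sub_one_of_pos (by norm_num : (0 : ℝ) < 3)]
  have hlogN : Real.log N = n * Real.log 3 := by rw [hNr, Real.log_pow]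
  obtain ⟨ω, hω⟩ := exists_stickyMap_lintegral_slice_le n
  have hcard : Fintype.card (TriadicIndex n) = Fintype.card (Fin N) := by
    rw [TriadicIndex.card, Fintype.card_fin, hN]
  let e : TriadicIndex n ≃ Fin N := Fintype.equivOfCardEq hcard
  let Q : TriadicIndex n → Parallelogram := fun v =>
    thinParallelogram ((v.pos n : ℝ) / 3 ^ n) (ω.slope n v) (1 / N) hh hh1
  have hmem (v : TriadicIndex n) (p : Plane) :
      ((v.pos n : ℝ) / 3 ^ n ≤ p 1 - p 0 * ω.slope n v ∧
        p 1 - p 0 * ω.slope n v ≤ (v.pos n : ℝ) / 3 ^ n + 1 / N) ↔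
      ((v.pos n : ℝ) / 3 ^ n ≤ p 1 - p 0 * ω.slope n v ∧
        p 1 - p 0 * ω.slope n v ≤ (v.pos n + 1 : ℝ) / 3 ^ n) := by
    rw [hNr, ← add_div]
  have hcU : MeasurableSet (⋃ v, (Q v).carrier) :=
    MeasurableSet.iUnion fun v => (isCompact_carrier _).measurableSet
  have hdU : MeasurableSet (⋃ v, (Q v).double) :=
    MeasurableSet.iUnion fun v => (isCompact_double _).measurableSet
  have hup : volume (⋃ v, (Q v).carrier) ≤ ENNReal.ofReal (112 / (n + 1)) := by
    refine le_trans ?_ hω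
    rw [volume_plane hcU, ← lintegral_indicator measurableSet_Icc]
    refine lintegral_mono fun x => ?_
    by_cases hx : x ∈ Set.Icc (2 : ℝ) 6
    · rw [Set.indicator_of_mem hx]
      refine measure_mono fun y hy => ?_
      obtain ⟨v, hv⟩ := Set.mem_iUnion.1 hy
      exact ⟨v, (hmem v !₂[x, y]).1 ((mem_carrier_thinParallelogram hh hh1 _).1 hv).2⟩
    · rw [Set.indicator_of_notMem hx, nonpos_iff_eq_zero, ← measure_empty (μ := (volume : Measure ℝ))]
      congr 1
      rw [Set.eq_empty_iff_forall_notMem]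
      intro y hy
      obtain ⟨v, hv⟩ := Set.mem_iUnion.1 hy
      exact hx ((mem_carrier_thinParallelogram hh hh1 _).1 hv).1
  have hlow : ENNReal.ofReal (Real.log (2 * n) / (340 * n)) ≤ volume (⋃ v, (Q v).double) := by
    refine (ω.log_div_le_lintegral_slice hn).trans ?_
    rw [volume_plane hdU, ← lintegral_indicator measurableSet_Icc]
    refine lintegral_mono fun x => ?_
    -- Over `0 ≤ x ≤ 1` each strip is contained in the double of its parallelogram.
    by_cases hx : x ∈ Set.Icc (0 : ℝ) 1
    · rw [Set.indicator_of_mem hx]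
      refine measure_mono ?_
      rintro y ⟨v, hv⟩
      have hv' := (hmem v !₂[x, y]).2 hv
      exact Set.mem_iUnion.2 ⟨v, mem_double_thinParallelogram hh hh1 hx hv'.1 hv'.2⟩
    · rw [Set.indicator_of_notMem hx]
      exact zero_le
  refine ⟨fun j => Q (e.symm j), ?_, ?_, ?_, ?_⟩
  · intro j k hjk
    have h1 := eq_of_carrier_thinParallelogram_eq hh hh1 hjk
    have h2 : ((e.symm j).pos n : ℝ) = (e.symm k).pos n :=
      (div_left_inj' (by positivity)).1 h1
    exact e.symm.injective (TriadicIndex.pos_injective n (by exact_mod_cast h2))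
  · intro j
    beta_reduce
    generalize e.symm j = v
    have hs := ω.slope_mem_Icc n v
    have hlong := norm_longSide_thinParallelogram (t := (v.pos n : ℝ) / 3 ^ n) hh hh1 hs
    have hshort := norm_shortSide_thinParallelogram (t := (v.pos n : ℝ) / 3 ^ n)
      (s := ω.slope n v) hh hh1
    have hwidth := width_thinParallelogram (t := (v.pos n : ℝ) / 3 ^ n) hh hh1 hs
    have hw0 := lt_of_lt_of_le (by positivity) hwidth.1
    refine ⟨⟨?_, ?_⟩, ⟨?_, ?_⟩, ⟨?_, ?_⟩, ?_, ?_⟩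
    · simp only [Parallelogram.eccentricity, Q]
      rw [hshort, div_div_eq_mul_div, div_one]
      gcongr
      linarith [hlong.1]
    · simp only [Parallelogram.eccentricity, Q]
      rw [hshort, div_div_eq_mul_div, div_one]
      gcongr
      linarith [hlong.2]
    · simp only [Parallelogram.widthEccentricity, Q]
      rw [le_div_iff₀ hw0]
      calc 1 / 340 * (N : ℝ) * _ ≤ 1 / 340 * N * (1 / N) := by gcongr; exact hwidth.2
        _ = 1 / 340 := by field_simp
        _ ≤ _ := by linarith [hlong.1]
    · simp only [Parallelogram.widthEccentricity, Q]
      rw [div_le_iff₀ hw0]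
      calc _ ≤ (8 : ℝ) := hlong.2
        _ ≤ 224 * N * (1 / N / 2) := by field_simp; norm_num
        _ ≤ _ := by gcongr; exact hwidth.1
    · rw [volume_carrier_thinParallelogram]
      refine ENNReal.ofReal_le_ofReal ?_
      rw [mul_one_div]
      gcongr
      norm_num
    · rw [volume_carrier_thinParallelogram]
      refine ENNReal.ofReal_le_ofReal ?_
      rw [mul_one_div]
      gcongr
      norm_num
    · simp [Q, thinParallelogram]
    · have : (Q v).longSide 1 / (Q v).longSide 0 = ω.slope n v := by
        simp [Q, thinParallelogram]
      rw [this]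
      exact ω.slope_mem n v
  · rw [e.symm.surjective.iUnion_comp fun v => (Q v).carrier]
    refine hup.trans (ENNReal.ofReal_le_ofReal ?_)
    rw [hlogN, div_le_div_iff₀ (by positivity) (by positivity)]
    nlinarith
  · rw [e.symm.surjective.iUnion_comp fun v => (Q v).double]
    refine le_trans (ENNReal.ofReal_le_ofReal ?_) hlow
    rw [hlogN]
    have h1 : Real.log (n * Real.log 3) ≤ Real.log (2 * n) := by
      refine Real.log_le_log (by positivity) ?_
      nlinarith
    have h2 : 0 ≤ Real.log (2 * n) := Real.log_nonneg (by linarith)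
    calc 1 / 340 * (Real.log (n * Real.log 3) / (n * Real.log 3))
        ≤ 1 / 340 * (Real.log (2 * n) / (n * 1)) := by gcongr
      _ = _ := by field_simp
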